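/- Let $p$ be a prime number, let $\mathbb{Z}_{(p)}\subset\mathbb{Q}$ be the localization of $\mathbb{Z}$ at $(p)$, and let $D=\mathbb{Z}_{(p)}+(X,Y)\mathbb{Q}[[X,Y]]$, a subring of $\mathbb{Q}[[X,Y]]$. Call a nonzero nonunit $r$ of an integral domain *rigid* if for all divisors $x,y$ of $r$ we have $x\mid y$ or $y\mid x$, and *packed* if $r$ and all its positive powers are rigid and $\sqrt{(r)}$ is a prime ideal. A domain is *semirigid* (respectively *semi packed*, or an *SPD*) if every nonzero nonunit is a finite product of rigid (respectively packed) elements; a *semirigid GCD domain* is a GCD domain that is semirigid. A domain is *Schreier* if it is integrally closed and every nonzero element $a$ is primal, i.e. $a\mid bc$ implies $a=rs$ with $r\mid b$ and $s\mid c$. Nonzero elements $a,b$ of a domain $D$ are *$v$-coprime* if $aD\cap bD=abD$ (equivalently, $(a,b)_v=D$, where $I_v=(I^{-1})^{-1}$). Then $D$ is a Schreier domain, a semirigid domain and a semi packed domain. The elements $X$ and $Y$ of $D$ are rigid, and they are not $v$-coprime, i.e. $XD\cap YD\neq XYD$ and $(X,Y)_v\neq D$; but the product $XY$ is not rigid.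 Moreover $D$ is not a semirigid GCD domain, so $D$ is an SPD that is not a semirigid GCD domain. -/

import Mathlib

/-- A rigid element: a nonzero nonunit any two of whose divisors are comparable under
divisibility. -/
def IsRigid {R : Type*} [CommRing R] (r : R) : Prop :=
  r ≠ 0 ∧ ¬ IsUnit r ∧ ∀ x y : R, x ∣ r → y ∣ r → x ∣ y ∨ y ∣ x

/-- A packed element: a rigid element all of whose positive powers are rigid and whose principal
ideal has prime radical. -/
def IsPacked {R : Type*} [CommRing R] (q : R) : Prop :=
  IsRigid q ∧ (∀ n : ℕ, 1 ≤ n → IsRigid (q ^ n)) ∧ (Ideal.span {q}).radical.IsPrime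

/-- A semirigid domain: every nonzero nonunit is a finite product of rigid elements. -/
def IsSemirigid (R : Type*) [CommRing R] [IsDomain R] : Prop :=
  ∀ a : R, a ≠ 0 → ¬ IsUnit a → ∃ s : Multiset R, (∀ q ∈ s, IsRigid q) ∧ s.prod = a

/-- A semi packed domain (SPD): every nonzero nonunit is a finite product of packed elements. -/
def IsSemiPacked (R : Type*) [CommRing R] [IsDomain R] : Prop :=
  ∀ a : R, a ≠ 0 → ¬ IsUnit a → ∃ s : Multiset R, (∀ q ∈ s, IsPacked q) ∧ s.prod = a

/-- A Schreier domain: an integrally closed domain all of whose nonzero elements are primal. -/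
def IsSchreier (R : Type*) [CommRing R] [IsDomain R] : Prop :=
  IsIntegrallyClosed R ∧ ∀ a : R, a ≠ 0 → IsPrimal a

/-- A semirigid GCD domain: a semirigid domain in which any two elements have a greatest common
divisor. -/
def IsSemirigidGCD (R : Type*) [CommRing R] [IsDomain R] : Prop :=
  IsSemirigid R ∧ Nonempty (GCDMonoid R)

/-- `a` and `b` are `v`-coprime: `aR ∩ bR = abR`. -/
def IsVCoprime {R : Type*} [CommRing R] (a b : R) : Prop :=
  Ideal.span {a} ⊓ Ideal.span {b} = Ideal.span {a * b}

/-- The `v`-closure `(I⁻¹)⁻¹` of an ideal, as a fractional ideal of the quotient field. -/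
noncomputable def vClosure {R : Type*} [CommRing R] [IsDomain R] (I : Ideal R) :
    FractionalIdeal (nonZeroDivisors R) (FractionRing R) :=
  ((I : FractionalIdeal (nonZeroDivisors R) (FractionRing R))⁻¹)⁻¹

/-- The ring `ℤ_(p)`, as a subring of `ℚ`: the fractions with denominator prime to `p`. -/
def ZLocal (p : ℕ) [hp : Fact p.Prime] : Subring ℚ where
  carrier := {q | ∃ a b : ℤ, ¬ (p : ℤ) ∣ b ∧ q = (a : ℚ) / (b : ℚ)}
  zero_mem' := ⟨0, 1, (Nat.prime_iff_prime_int.mp hp.out).not_dvd_one, by simp⟩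
  one_mem' := ⟨1, 1, (Nat.prime_iff_prime_int.mp hp.out).not_dvd_one, by simp⟩
  neg_mem' := by
    rintro _ ⟨a, b, hb, rfl⟩
    exact ⟨-a, b, hb, by push_cast; ring⟩
  add_mem' := by
    rintro _ _ ⟨a, b, hb, rfl⟩ ⟨c, d, hd, rfl⟩
    have hb0 : (b : ℚ) ≠ 0 := by rintro h; apply hb; simp [Int.cast_eq_zero.mp h]
    have hd0 : (d : ℚ) ≠ 0 := by rintro h; apply hd; simp [Int.cast_eq_zero.mp h]
    exact ⟨a * d + b * c, b * d, (Nat.prime_iff_prime_int.mp hp.out).not_dvd_mul hb hd, by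
      push_cast; exact div_add_div _ _ hb0 hd0⟩
  mul_mem' := by
    rintro _ _ ⟨a, b, hb, rfl⟩ ⟨c, d, hd, rfl⟩
    exact ⟨a * c, b * d, (Nat.prime_iff_prime_int.mp hp.out).not_dvd_mul hb hd, by
      push_cast; exact div_mul_div_comm _ _ _ _⟩

/-- The ideal `(X, Y)` of `ℚ⟦X, Y⟧`, where `X`, `Y` are the variables with index `0`, `1`. -/
noncomputable def idealXY : Ideal (MvPowerSeries (Fin 2) ℚ) :=
  Ideal.span {MvPowerSeries.X 0, MvPowerSeries.X 1}

/-- The ring `D = ℤ_(p) + (X, Y)ℚ⟦X, Y⟧`, as a subring of `ℚ⟦X, Y⟧`. -/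
noncomputable def ringD (p : ℕ) [Fact p.Prime] : Subring (MvPowerSeries (Fin 2) ℚ) where
  carrier := {f | ∃ a ∈ ZLocal p, ∃ g ∈ idealXY, f = MvPowerSeries.C a + g}
  zero_mem' := ⟨0, zero_mem _, 0, zero_mem _, by simp⟩
  one_mem' := ⟨1, one_mem _, 0, zero_mem _, by simp⟩
  neg_mem' := by
    rintro _ ⟨a, ha, g, hg, rfl⟩
    exact ⟨-a, neg_mem ha, -g, neg_mem hg, by rw [map_neg]; ring⟩
  add_mem' := by
    rintro _ _ ⟨a, ha, g, hg, rfl⟩ ⟨b, hb, h, hh, rfl⟩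
    exact ⟨a + b, add_mem ha hb, g + h, add_mem hg hh, by rw [map_add]; ring⟩
  mul_mem' := by
    rintro _ _ ⟨a, ha, g, hg, rfl⟩ ⟨b, hb, h, hh, rfl⟩
    exact ⟨a * b, mul_mem ha hb, MvPowerSeries.C a * h + (MvPowerSeries.C b + h) * g,
      add_mem (Ideal.mul_mem_left _ _ hh) (Ideal.mul_mem_left _ _ hg), by rw [map_mul]; ring⟩

/-- The variable `X`, as an element of `D`. -/
noncomputable def elemX (p : ℕ) [Fact p.Prime] : ringD p :=
  ⟨MvPowerSeries.X 0, 0, zero_mem _, _, Ideal.subset_span (Set.mem_insert _ _), by simp⟩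

/-- The variable `Y`, as an element of `D`. -/
noncomputable def elemY (p : ℕ) [Fact p.Prime] : ringD p :=
  ⟨MvPowerSeries.X 1, 0, zero_mem _, _,
    Ideal.subset_span (Set.mem_insert_of_mem _ (Set.mem_singleton _)), by simp⟩

instance instIsDomainRingD (p : ℕ) [Fact p.Prime] : IsDomain (ringD p) :=
  have : Nontrivial (ringD p) := inferInstance
  have : NoZeroDivisors (ringD p) := inferInstance
  NoZeroDivisors.to_isDomain _

/-!
Write `S = ℚ⟦X, Y⟧` and `M = (X, Y)S`. The ring `D = ℤ_(p) + M` consists of the power series whose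
constant coefficient lies in the valuation ring `ℤ_(p)` (`RingD.mem_ringD_iff`), and `S` is a local
unique factorization domain, being isomorphic to the power series ring in one variable over the
principal ideal domain `ℚ⟦Y⟧` (`RingD.instUFD`).

The main tool is `RingD.dvd_or_dvd_of_coe_dvd`: if `x` divides `y` in `S`, then `x` and `y` are
comparable in `D`, since the constant coefficient of the quotient, or that of its inverse, lies in
`ℤ_(p)`. Hence an element of `D` is rigid as soon as its divisors in `S` form a chain. This applies
to the powers of a prime of `S`, and to the nonunits of `D` with nonzero constant coefficient, which
are units of `S`. The primes of `S` and the elements of the second kind are packed, and every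
nonzero nonunit of `D` is of the second kind or a product of primes of `S`. The same tool, with the
primality of elements in `S`, gives the primality of elements in `D` (`RingD.isPrimal_ringD`).

The divisors `X` and `Y` of `XY` are incomparable, so `XY` is not rigid. The other negative
statements come from the fact that `p` is a nonunit dividing every element of `M`:
`XY / p` witnesses that `X` and `Y` are not `v`-coprime, `1 / p` lies in `(X, Y)⁻¹`, and multiplying
a common divisor of `X` and `Y` by `p` gives another one, so that `X` and `Y` have no greatest common
divisor.
-/

namespace RingD

open MvPowerSeries

/-! ### The valuation ring `ℤ_(p)` -/

section ZLocal

variable {p : ℕ} [hp : Fact p.Prime]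

theorem mem_ZLocal_iff {q : ℚ} : q ∈ ZLocal p ↔ padicNorm p q ≤ 1 := by
  constructor
  · rintro ⟨a, b, hb, rfl⟩
    rw [padicNorm.div, (padicNorm.int_eq_one_iff b).2 hb, div_one]
    exact padicNorm.of_int a
  · intro h
    refine ⟨q.num, q.den, fun hd => ?_, (Rat.num_div_den q).symm⟩
    have hn : ¬ (p : ℤ) ∣ q.num := fun hn =>
      hp.out.one_lt.ne' (Nat.eq_one_of_dvd_coprimes q.reduced (Int.natCast_dvd.1 hn)
        (Int.natCast_dvd_natCast.1 hd))
    have h1 : padicNorm p (q.num : ℚ) = 1 := (padicNorm.int_eq_one_iff _).2 hn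
    have h2 : padicNorm p (q.den : ℚ) < 1 := by
      exact_mod_cast (padicNorm.int_lt_one_iff (q.den : ℤ)).2 hd
    have h3 : padicNorm p q * padicNorm p (q.den : ℚ) = 1 := by
      rw [← padicNorm.mul, Rat.mul_den_eq_num, h1]
    have := padicNorm.nonneg (p := p) (q.den : ℚ)
    nlinarith

theorem mem_ZLocal_or_inv_mem (q : ℚ) : q ∈ ZLocal p ∨ q⁻¹ ∈ ZLocal p := by
  rw [mem_ZLocal_iff, mem_ZLocal_iff]
  rcases eq_or_ne q 0 with rfl | hq
  · simp
  · have h : padicNorm p q * padicNorm p q⁻¹ = 1 := by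
      rw [← padicNorm.mul, mul_inv_cancel₀ hq, padicNorm.one]
    by_contra! hc
    nlinarith [hc.1, hc.2]

variable (p) in
/-- `ℤ_(p)` as a valuation subring of `ℚ`. -/
def ZLocalValuation : ValuationSubring ℚ where
  toSubring := ZLocal p
  mem_or_inv_mem' := mem_ZLocal_or_inv_mem

end ZLocal

/-! ### The power series ring `ℚ⟦X, Y⟧` -/

instance instUFD : UniqueFactorizationMonoid (MvPowerSeries (Fin 2) ℚ) := by
  let e : MvPowerSeries (Fin 1) ℚ ≃+* PowerSeries ℚ :=
    (MvPowerSeries.renameEquiv ℚ (Equiv.equivPUnit (Fin 1))).toRingEquiv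
  have : IsDomain (MvPowerSeries (Fin 1) ℚ) := NoZeroDivisors.to_isDomain _
  have : IsPrincipalIdealRing (MvPowerSeries (Fin 1) ℚ) :=
    IsPrincipalIdealRing.of_surjective e.symm.toRingHom e.symm.surjective
  exact (MvPowerSeries.finSuccEquiv ℚ 1).symm.toMulEquiv.uniqueFactorizationMonoid inferInstance

theorem mem_idealXY_iff {f : MvPowerSeries (Fin 2) ℚ} :
    f ∈ idealXY ↔ constantCoeff f = 0 := by
  constructor
  · intro h
    obtain ⟨a, b, rfl⟩ := Ideal.mem_span_pair.1 h
    simp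
  · intro h
    -- `g` collects the monomials of `f` that do not involve `X`.
    let g : MvPowerSeries (Fin 2) ℚ := fun n => if n 0 = 0 then coeff n f else 0
    have hg : ∀ n, coeff n g = if n 0 = 0 then coeff n f else 0 := fun n => rfl
    have h0 : X 0 ∣ f - g := X_dvd_iff.2 fun m hm => by simp [hg, hm]
    have h1 : X 1 ∣ g := X_dvd_iff.2 fun m hm => by
      rw [hg]
      split_ifs with hm0
      · have : m = 0 := by
          ext i
          fin_cases i
          · exact hm0
          · exact hm
        rw [this]
        simpa using h
      · rfl
    obtain ⟨a, ha⟩ := h0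
    obtain ⟨b, hb⟩ := h1
    refine Ideal.mem_span_pair.2 ⟨a, b, ?_⟩
    rw [mul_comm a, mul_comm b, ← ha, ← hb, sub_add_cancel]

theorem isUnit_iff_constantCoeff_ne_zero {f : MvPowerSeries (Fin 2) ℚ} :
    IsUnit f ↔ constantCoeff f ≠ 0 := by
  rw [MvPowerSeries.isUnit_iff_constantCoeff, isUnit_iff_ne_zero]

theorem not_X_dvd_X {i j : Fin 2} (hij : i ≠ j) :
    ¬ (X i : MvPowerSeries (Fin 2) ℚ) ∣ X j := by
  intro h
  have h1 := X_dvd_iff.1 h (Finsupp.single j 1) (by simp [hij.symm])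
  simp [coeff_X] at h1

theorem mvPowerSeries_X_ne_zero (i : Fin 2) : (X i : MvPowerSeries (Fin 2) ℚ) ≠ 0 := fun h => by
  have := congrArg (coeff (Finsupp.single i 1)) h
  simp [coeff_X] at this

/-- A divisor of `X i` with zero constant coefficient is an associate of `X i`, because `X i` has a
nonzero coefficient of degree one. -/
theorem X_dvd_of_dvd_X {i : Fin 2} {g : MvPowerSeries (Fin 2) ℚ} (h : g ∣ X i)
    (hg : constantCoeff g = 0) : X i ∣ g := by
  obtain ⟨k, hk⟩ := h
  have hk0 : IsUnit k := by
    rw [isUnit_iff_constantCoeff_ne_zero]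
    intro hk0
    have h1 : (2 : ℕ∞) ≤ (g * k).order := by
      have hg1 : 1 ≤ g.order := by
        rw [one_le_order_iff_constCoeff_eq_zero]; exact hg
      have hk1 : 1 ≤ k.order := by
        rw [one_le_order_iff_constCoeff_eq_zero]; exact hk0
      calc (2 : ℕ∞) = 1 + 1 := by norm_num
        _ ≤ g.order + k.order := add_le_add hg1 hk1
        _ ≤ _ := le_order_mul
    have h2 : coeff (Finsupp.single i 1) (g * k) = 0 := by
      apply coeff_of_lt_order
      refine lt_of_lt_of_le ?_ h1
      simp
    rw [← hk, coeff_X] at h2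
    simp at h2
  obtain ⟨u, rfl⟩ := hk0
  exact ⟨↑u⁻¹, by rw [hk, mul_assoc, Units.mul_inv, mul_one]⟩

theorem prime_X (i : Fin 2) : Prime (X i : MvPowerSeries (Fin 2) ℚ) := by
  rw [← UniqueFactorizationMonoid.irreducible_iff_prime]
  refine ⟨fun h => isUnit_iff_constantCoeff_ne_zero.1 h (by simp), fun a b hab => ?_⟩
  simp only [isUnit_iff_constantCoeff_ne_zero]
  by_contra! hc
  obtain ⟨c, hc'⟩ := X_dvd_of_dvd_X ⟨b, hab⟩ hc.1
  have h1 : (X i : MvPowerSeries (Fin 2) ℚ) * 1 = X i * (c * b) := by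
    rw [← mul_assoc, ← hc', ← hab, mul_one]
  have h2 := congrArg constantCoeff (mul_left_cancel₀ (mvPowerSeries_X_ne_zero i) h1)
  simp [hc.2] at h2

/-! ### Divisibility in `D` -/

variable {p : ℕ} [hp : Fact p.Prime]

theorem mem_ringD_iff {f : MvPowerSeries (Fin 2) ℚ} :
    f ∈ ringD p ↔ constantCoeff f ∈ ZLocal p := by
  constructor
  · rintro ⟨a, ha, g, hg, rfl⟩
    simpa [mem_idealXY_iff.1 hg] using ha
  · intro h
    exact ⟨_, h, f - C (constantCoeff f), mem_idealXY_iff.2 (by simp), by ring⟩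

theorem mem_ringD_of_constantCoeff_eq_zero {f : MvPowerSeries (Fin 2) ℚ}
    (h : constantCoeff f = 0) : f ∈ ringD p :=
  mem_ringD_iff.2 (h ▸ zero_mem _)

theorem dvd_iff_exists_mem {x y : ringD p} :
    x ∣ y ↔ ∃ g ∈ ringD p, (y : MvPowerSeries (Fin 2) ℚ) = x * g :=
  ⟨fun ⟨c, hc⟩ => ⟨c, c.2, by rw [hc]; rfl⟩, fun ⟨g, hg, h⟩ => ⟨⟨g, hg⟩, Subtype.ext h⟩⟩

theorem coe_dvd_coe {x y : ringD p} (h : x ∣ y) : (x : MvPowerSeries (Fin 2) ℚ) ∣ y :=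
  map_dvd (ringD p).subtype h

/-- Elements that are comparable in `ℚ⟦X, Y⟧` are comparable in `D`: the quotient, or else its
inverse, has constant coefficient in the valuation ring `ℤ_(p)`. -/
theorem dvd_or_dvd_of_coe_dvd {x y : ringD p} (h : (x : MvPowerSeries (Fin 2) ℚ) ∣ y) :
    x ∣ y ∨ y ∣ x := by
  obtain ⟨g, hg⟩ := h
  by_cases hgD : g ∈ ringD p
  · exact Or.inl (dvd_iff_exists_mem.2 ⟨g, hgD, hg⟩)
  · have hg0 : constantCoeff g ≠ 0 := fun h0 => hgD (mem_ringD_of_constantCoeff_eq_zero h0)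
    refine Or.inr (dvd_iff_exists_mem.2 ⟨g⁻¹, mem_ringD_iff.2 ?_, ?_⟩)
    · rw [constantCoeff_inv]
      exact (mem_ZLocal_or_inv_mem _).resolve_left fun h => hgD (mem_ringD_iff.2 h)
    · rw [hg, mul_assoc, MvPowerSeries.mul_inv_cancel g hg0, mul_one]

theorem padicNorm_lt_one_of_not_isUnit {x : ringD p} (hx : ¬ IsUnit x) :
    padicNorm p (constantCoeff (x : MvPowerSeries (Fin 2) ℚ)) < 1 := by
  refine lt_of_le_of_ne (mem_ZLocal_iff.1 (mem_ringD_iff.1 x.2)) fun h1 => hx ?_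
  have h0 : constantCoeff (x : MvPowerSeries (Fin 2) ℚ) ≠ 0 := fun h0 => by simp [h0] at h1
  refine isUnit_of_dvd_one (dvd_iff_exists_mem.2 ⟨(x : MvPowerSeries (Fin 2) ℚ)⁻¹, ?_, ?_⟩)
  · rw [mem_ringD_iff, mem_ZLocal_iff, constantCoeff_inv, inv_eq_one_div, padicNorm.div, h1]
    simp
  · rw [MvPowerSeries.mul_inv_cancel _ h0]; rfl

/-- The archimedean property of `ℤ_(p)`, lifted to `D`. -/
theorem exists_dvd_pow {a x : ringD p} (hx : ¬ IsUnit x)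
    (ha : constantCoeff (a : MvPowerSeries (Fin 2) ℚ) ≠ 0) : ∃ n : ℕ, a ∣ x ^ n := by
  have hpos : 0 < padicNorm p (constantCoeff (a : MvPowerSeries (Fin 2) ℚ)) :=
    lt_of_le_of_ne (padicNorm.nonneg _) (padicNorm.nonzero ha).symm
  obtain ⟨n, hn⟩ := exists_pow_lt_of_lt_one hpos (padicNorm_lt_one_of_not_isUnit hx)
  have hpow : ∀ (q : ℚ) (n : ℕ), padicNorm p (q ^ n) = padicNorm p q ^ n := fun q n => by
    induction n with
    | zero => simp
    | succ n ih => rw [pow_succ, pow_succ, padicNorm.mul, ih]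
  refine ⟨n, dvd_iff_exists_mem.2
    ⟨(x : MvPowerSeries (Fin 2) ℚ) ^ n * (a : MvPowerSeries (Fin 2) ℚ)⁻¹, ?_, ?_⟩⟩
  · rw [mem_ringD_iff, mem_ZLocal_iff, map_mul, map_pow, constantCoeff_inv, ← div_eq_mul_inv,
      padicNorm.div, hpow, div_le_one hpos]
    exact hn.le
  · rw [mul_left_comm, MvPowerSeries.mul_inv_cancel _ ha, mul_one]; rfl

/-! ### Rigid and packed elements -/

theorem isRigid_of_forall_coe {r : ringD p} (h0 : r ≠ 0) (h1 : ¬ IsUnit r)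
    (h : ∀ x y : MvPowerSeries (Fin 2) ℚ, x ∣ r → y ∣ r → x ∣ y ∨ y ∣ x) : IsRigid r :=
  ⟨h0, h1, fun x y hx hy => (h x y (coe_dvd_coe hx) (coe_dvd_coe hy)).elim
    dvd_or_dvd_of_coe_dvd fun h => (dvd_or_dvd_of_coe_dvd h).symm⟩

theorem isRigid_of_dvd_prime_pow {r : ringD p} (h0 : r ≠ 0) (h1 : ¬ IsUnit r)
    {q : MvPowerSeries (Fin 2) ℚ} (hq : Prime q) {n : ℕ}
    (hr : (r : MvPowerSeries (Fin 2) ℚ) ∣ q ^ n) : IsRigid r := by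
  refine isRigid_of_forall_coe h0 h1 fun x y hx hy => ?_
  obtain ⟨i, -, hi⟩ := (dvd_prime_pow hq n).1 (hx.trans hr)
  obtain ⟨j, -, hj⟩ := (dvd_prime_pow hq n).1 (hy.trans hr)
  rw [hi.dvd_iff_dvd_left, hi.dvd_iff_dvd_right, hj.dvd_iff_dvd_left, hj.dvd_iff_dvd_right]
  exact (le_total i j).imp (pow_dvd_pow q) (pow_dvd_pow q)

theorem isPacked_of_forall_isRigid_pow {q : ringD p} (h : ∀ n : ℕ, 1 ≤ n → IsRigid (q ^ n))
    (hrad : (Ideal.span {q}).radical.IsPrime) : IsPacked q :=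
  ⟨by simpa using h 1 le_rfl, h, hrad⟩

theorem not_isUnit_of_constantCoeff_eq_zero {q : ringD p}
    (h : constantCoeff (q : MvPowerSeries (Fin 2) ℚ) = 0) : ¬ IsUnit q := fun hu =>
  isUnit_iff_constantCoeff_ne_zero.1 (hu.map (ringD p).subtype) h

/-- A prime of `ℚ⟦X, Y⟧` lies in `D` and is packed there: the radical of `qD` is
`qℚ⟦X, Y⟧ ∩ D`, since `(qg)² = q(qg²)` with `qg²` in `D`. -/
theorem isPacked_of_prime_coe {q : ringD p} (hq : Prime (q : MvPowerSeries (Fin 2) ℚ)) :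
    IsPacked q := by
  have hc : constantCoeff (q : MvPowerSeries (Fin 2) ℚ) = 0 :=
    not_not.1 fun h => hq.not_isUnit (isUnit_iff_constantCoeff_ne_zero.2 h)
  have hq0 : q ≠ 0 := fun h => hq.ne_zero (by rw [h]; rfl)
  refine isPacked_of_forall_isRigid_pow (fun n hn => ?_) ?_
  · exact isRigid_of_dvd_prime_pow (pow_ne_zero n hq0)
      (fun hu => not_isUnit_of_constantCoeff_eq_zero hc ((isUnit_pow_iff (by omega)).1 hu))
      hq (n := n) (by rw [SubmonoidClass.coe_pow])
  · have hrad : (Ideal.span {q}).radical =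
        (Ideal.span {(q : MvPowerSeries (Fin 2) ℚ)}).comap (ringD p).subtype := by
      ext f
      rw [Ideal.mem_comap, Ideal.mem_span_singleton]
      constructor
      · rintro ⟨n, hn⟩
        have := coe_dvd_coe (Ideal.mem_span_singleton.1 hn)
        rw [SubmonoidClass.coe_pow] at this
        exact hq.dvd_of_dvd_pow this
      · rintro ⟨g, hg⟩
        refine ⟨2, Ideal.mem_span_singleton.2 (dvd_iff_exists_mem.2
          ⟨q * g ^ 2, mem_ringD_of_constantCoeff_eq_zero (by simp [hc]), ?_⟩)⟩
        rw [SubmonoidClass.coe_pow]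
        rw [Subring.subtype_apply] at hg
        rw [hg]; ring
    rw [hrad]
    have := (Ideal.span_singleton_prime hq.ne_zero).2 hq
    exact Ideal.IsPrime.comap _

/-- A nonunit of `D` with nonzero constant coefficient (an associate of a power of `p`) is packed:
it becomes a unit in `ℚ⟦X, Y⟧`, and the radical it generates is the set of all nonunits. -/
theorem isPacked_of_constantCoeff_ne_zero {q : ringD p} (h1 : ¬ IsUnit q)
    (hc : constantCoeff (q : MvPowerSeries (Fin 2) ℚ) ≠ 0) : IsPacked q := by
  have hq0 : q ≠ 0 := fun h => hc (by rw [h]; exact map_zero _)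
  have hu := isUnit_iff_constantCoeff_ne_zero.2 hc
  refine isPacked_of_forall_isRigid_pow (fun n hn => ?_) ⟨?_, ?_⟩
  · refine isRigid_of_forall_coe (pow_ne_zero n hq0)
      (fun hu => h1 ((isUnit_pow_iff (by omega)).1 hu)) fun x y hx _ => Or.inl ?_
    rw [SubmonoidClass.coe_pow] at hx
    exact (isUnit_of_dvd_unit hx (hu.pow n)).dvd
  · rw [Ne, Ideal.radical_eq_top, Ideal.span_singleton_eq_top]
    exact h1
  · have key : ∀ x : ringD p, x ∈ (Ideal.span {q}).radical ↔ ¬ IsUnit x := fun x => by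
      constructor
      · rintro ⟨n, hn⟩ hx
        exact h1 (isUnit_of_dvd_unit (Ideal.mem_span_singleton.1 hn) (hx.pow n))
      · intro hx
        obtain ⟨n, hn⟩ := exists_dvd_pow hx hc
        exact ⟨n, Ideal.mem_span_singleton.2 hn⟩
    intro x y hxy
    rw [key, IsUnit.mul_iff, not_and_or] at hxy
    rwa [key, key]

variable (p) in
theorem isSemiPacked_ringD : IsSemiPacked (ringD p) := by
  intro a ha h1
  by_cases hc : constantCoeff (a : MvPowerSeries (Fin 2) ℚ) = 0
  · have ha' : (a : MvPowerSeries (Fin 2) ℚ) ≠ 0 := fun h => ha (Subtype.ext h)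
    have hmem : ∀ q : MvPowerSeries (Fin 2) ℚ, Prime q → q ∈ ringD p := fun q hq =>
      mem_ringD_of_constantCoeff_eq_zero
        (not_not.1 fun h => hq.not_isUnit (isUnit_iff_constantCoeff_ne_zero.2 h))
    -- The unit left over by the factorization in `ℚ⟦X, Y⟧` is absorbed into one prime factor.
    obtain ⟨s, hs, hsa⟩ := UniqueFactorizationMonoid.exists_prime_factors _ ha'
    have hne : s ≠ 0 := by
      rintro rfl
      rw [Multiset.prod_zero] at hsa
      exact isUnit_iff_constantCoeff_ne_zero.1 (hsa.isUnit isUnit_one) hc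
    obtain ⟨q, hq⟩ := Multiset.exists_mem_of_ne_zero hne
    obtain ⟨t, rfl⟩ := Multiset.exists_cons_of_mem hq
    obtain ⟨u, hu⟩ := hsa
    have hs' : ∀ b ∈ (q * u) ::ₘ t, Prime b := by
      intro b hb
      rcases Multiset.mem_cons.1 hb with rfl | hb
      · exact (Associated.prime_iff ⟨u, rfl⟩).1 (hs q (Multiset.mem_cons_self _ _))
      · exact hs b (Multiset.mem_cons_of_mem hb)
    have hprod : ((q * u) ::ₘ t).prod = a := by
      rw [← hu, Multiset.prod_cons, Multiset.prod_cons]; ring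
    generalize (q * u) ::ₘ t = w at hs' hprod
    lift w to Multiset (ringD p) using fun b hb => hmem b (hs' b hb)
    refine ⟨w, fun b hb => isPacked_of_prime_coe (hs' _ (Multiset.mem_map_of_mem _ hb)), ?_⟩
    apply Subtype.ext
    rw [← hprod]
    exact map_multiset_prod (ringD p).subtype w
  · exact ⟨{a}, by simpa using isPacked_of_constantCoeff_ne_zero h1 hc, by simp⟩

/-! ### The Schreier property -/

variable (p) in
theorem isIntegrallyClosed_ringD : IsIntegrallyClosed (ringD p) := by
  rw [isIntegrallyClosed_iff (FractionRing (ringD p))]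
  rintro z ⟨P, hP, hz⟩
  let ι := algebraMap (MvPowerSeries (Fin 2) ℚ) (FractionRing (MvPowerSeries (Fin 2) ℚ))
  have hι : Function.Injective ι := IsFractionRing.injective _ _
  have hinj : Function.Injective (ι.comp (ringD p).subtype) := hι.comp Subtype.val_injective
  let ψ : FractionRing (ringD p) →+* FractionRing (MvPowerSeries (Fin 2) ℚ) :=
    IsFractionRing.lift hinj
  have hψ : ∀ x : ringD p, ψ (algebraMap _ _ x) = ι x := fun x =>
    IsFractionRing.lift_algebraMap hinj x
  have hψc : ψ.comp (algebraMap (ringD p) (FractionRing (ringD p))) =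
      ι.comp (ringD p).subtype := RingHom.ext hψ
  have hz' : P.eval₂ (ι.comp (ringD p).subtype) (ψ z) = 0 := by
    rw [← hψc, ← Polynomial.hom_eval₂, hz, map_zero]
  have hint : IsIntegral (MvPowerSeries (Fin 2) ℚ) (ψ z) :=
    ⟨P.map (ringD p).subtype, hP.map _, by rw [Polynomial.eval₂_map]; exact hz'⟩
  obtain ⟨g, hg⟩ := IsIntegrallyClosed.isIntegral_iff.1 hint
  have hPg : P.eval₂ (ringD p).subtype g = 0 := by
    apply hι
    rw [Polynomial.hom_eval₂, map_zero]
    rw [← hg] at hz'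
    exact hz'
  let φ : ringD p →+* ZLocalValuation p :=
    ((constantCoeff (σ := Fin 2) (R := ℚ)).comp (ringD p).subtype).codRestrict
      (ZLocalValuation p) fun x => mem_ringD_iff.1 x.2
  have hφ : (algebraMap (ZLocalValuation p) ℚ).comp φ =
      (constantCoeff (σ := Fin 2) (R := ℚ)).comp (ringD p).subtype := rfl
  have hgint : IsIntegral (ZLocalValuation p) (constantCoeff g) :=
    ⟨P.map φ, hP.map _, by
      rw [Polynomial.eval₂_map, hφ, ← Polynomial.hom_eval₂, hPg, map_zero]⟩
  obtain ⟨c, hc⟩ := IsIntegrallyClosed.isIntegral_iff.1 hgint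
  refine ⟨⟨g, mem_ringD_iff.2 (hc ▸ c.2)⟩, ψ.injective ?_⟩
  rw [hψ]
  exact hg

theorem exists_mul_mem_inv_mul_mem {u v : ℚ} (h : u * v ∈ ZLocal p) :
    ∃ t : ℚ, t ≠ 0 ∧ t * u ∈ ZLocal p ∧ t⁻¹ * v ∈ ZLocal p := by
  by_cases hu : u = 0
  · subst hu
    by_cases hv : v = 0
    · exact ⟨1, one_ne_zero, by simp, by simp [hv]⟩
    · exact ⟨v, hv, by simp, by rw [inv_mul_cancel₀ hv]; exact one_mem _⟩
  · exact ⟨u⁻¹, inv_ne_zero hu, by rw [inv_mul_cancel₀ hu]; exact one_mem _, by rwa [inv_inv]⟩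

/-- If `a` divides `b` in `ℚ⟦X, Y⟧`, then `a` and `b` are comparable in `D`, so `a ∣ bc` splits with
`a` or `b` as one of the two factors. -/
theorem exists_split_of_coe_dvd {a b c : ringD p} (ha : a ≠ 0) (habc : a ∣ b * c)
    (h : (a : MvPowerSeries (Fin 2) ℚ) ∣ b) : ∃ r s, r ∣ b ∧ s ∣ c ∧ a = r * s := by
  rcases dvd_or_dvd_of_coe_dvd h with h | ⟨e, rfl⟩
  · exact ⟨a, 1, h, one_dvd _, (mul_one a).symm⟩
  · exact ⟨b, e, dvd_rfl, (mul_dvd_mul_iff_left (left_ne_zero_of_mul ha)).1 habc, rfl⟩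

/-- When both factors of a splitting of `a` in `ℚ⟦X, Y⟧` are nonunits, they and all their rational
multiples lie in `D`; multiplying one by a rational number and the other by its inverse makes the
cofactors lie in `D` as well. -/
theorem isPrimal_ringD (a : ringD p) (ha : a ≠ 0) : IsPrimal a := by
  intro b c habc
  obtain ⟨r, s, ⟨b', hb⟩, ⟨c', hc⟩, hrs⟩ :=
    DecompositionMonoid.primal (a : MvPowerSeries (Fin 2) ℚ) (coe_dvd_coe habc)
  by_cases hr : IsUnit r
  · have : (a : MvPowerSeries (Fin 2) ℚ) ∣ c := by
      rw [hrs, hr.mul_left_dvd]; exact ⟨c', hc⟩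
    obtain ⟨x, y, hx, hy, h⟩ := exists_split_of_coe_dvd ha (mul_comm b c ▸ habc) this
    exact ⟨y, x, hy, hx, h.trans (mul_comm x y)⟩
  by_cases hs : IsUnit s
  · refine exists_split_of_coe_dvd ha habc ?_
    rw [hrs, hs.mul_right_dvd]; exact ⟨b', hb⟩
  rw [isUnit_iff_constantCoeff_ne_zero, not_not] at hr hs
  obtain ⟨d, hd, hd'⟩ := dvd_iff_exists_mem.1 habc
  have hbc : b' * c' = d := by
    have ha' : (a : MvPowerSeries (Fin 2) ℚ) ≠ 0 := fun h => ha (Subtype.ext h)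
    apply mul_left_cancel₀ ha'
    rw [← hd', Subring.coe_mul, hb, hc, hrs]; ring
  obtain ⟨t, ht, htb, htc⟩ := exists_mul_mem_inv_mul_mem (p := p)
    (u := constantCoeff b') (v := constantCoeff c')
    (by rw [← map_mul, hbc]; exact mem_ringD_iff.1 hd)
  have hCt : (C t : MvPowerSeries (Fin 2) ℚ) * C t⁻¹ = 1 := by
    rw [← map_mul, mul_inv_cancel₀ ht, map_one]
  refine ⟨⟨C t⁻¹ * r, mem_ringD_of_constantCoeff_eq_zero (by simp [hr])⟩,
    ⟨C t * s, mem_ringD_of_constantCoeff_eq_zero (by simp [hs])⟩,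
    dvd_iff_exists_mem.2 ⟨C t * b', mem_ringD_iff.2 (by simpa using htb), ?_⟩,
    dvd_iff_exists_mem.2 ⟨C t⁻¹ * c', mem_ringD_iff.2 (by simpa using htc), ?_⟩, Subtype.ext ?_⟩
  · linear_combination hb - r * b' * hCt
  · linear_combination hc - s * c' * hCt
  · rw [Subring.coe_mul]
    linear_combination hrs - r * s * hCt

/-! ### The elements `X` and `Y` -/

theorem coe_elemX : (elemX p : MvPowerSeries (Fin 2) ℚ) = X 0 := rfl

theorem coe_elemY : (elemY p : MvPowerSeries (Fin 2) ℚ) = X 1 := rfl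

theorem elemX_ne_zero : elemX p ≠ 0 := fun h => mvPowerSeries_X_ne_zero 0 (congrArg Subtype.val h)

theorem not_elemX_dvd_elemY : ¬ elemX p ∣ elemY p := fun h =>
  not_X_dvd_X (by decide) (coe_dvd_coe h)

theorem not_elemY_dvd_elemX : ¬ elemY p ∣ elemX p := fun h =>
  not_X_dvd_X (by decide) (coe_dvd_coe h)

theorem not_isUnit_natCast : ¬ IsUnit (p : ringD p) := by
  intro h
  obtain ⟨g, hg, h1⟩ := dvd_iff_exists_mem.1 (IsUnit.dvd h : (p : ringD p) ∣ 1)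
  have h2 := congrArg (fun f => padicNorm p (constantCoeff f)) h1
  simp only [Subring.coe_one, Subring.coe_natCast, map_mul, map_natCast, map_one, padicNorm.mul,
    padicNorm.one, padicNorm.padicNorm_p_of_prime] at h2
  have h3 := mem_ZLocal_iff.1 (mem_ringD_iff.1 hg)
  have h4 : (1 : ℚ) < p := by exact_mod_cast hp.out.one_lt
  have h5 : (p : ℚ)⁻¹ < 1 := inv_lt_one_of_one_lt₀ h4
  have h6 : 0 < (p : ℚ)⁻¹ := by positivity
  nlinarith

theorem dvd_of_constantCoeff_ne_zero_of_eq_zero {a f : ringD p}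
    (ha : constantCoeff (a : MvPowerSeries (Fin 2) ℚ) ≠ 0)
    (hf : constantCoeff (f : MvPowerSeries (Fin 2) ℚ) = 0) : a ∣ f :=
  dvd_iff_exists_mem.2 ⟨(a : MvPowerSeries (Fin 2) ℚ)⁻¹ * f,
    mem_ringD_of_constantCoeff_eq_zero (by simp [hf]),
    by rw [← mul_assoc, MvPowerSeries.mul_inv_cancel _ ha, one_mul]⟩

theorem natCast_dvd {f : ringD p} (hf : constantCoeff (f : MvPowerSeries (Fin 2) ℚ) = 0) :
    (p : ringD p) ∣ f :=
  dvd_of_constantCoeff_ne_zero_of_eq_zero (by simpa using hp.out.ne_zero) hf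

/-- The witness is `XY / p`. -/
theorem not_isVCoprime : ¬ IsVCoprime (elemX p) (elemY p) := by
  intro h
  obtain ⟨y, hy⟩ := natCast_dvd (p := p) (f := elemY p) (by simp [coe_elemY])
  obtain ⟨x, hx⟩ := natCast_dvd (p := p) (f := elemX p) (by simp [coe_elemX])
  have hmem : elemX p * y ∈ Ideal.span {elemX p} ⊓ Ideal.span {elemY p} := by
    refine ⟨Ideal.mem_span_singleton.2 ⟨y, rfl⟩, Ideal.mem_span_singleton.2 ⟨x, ?_⟩⟩
    rw [hx, hy]; ring
  rw [h, Ideal.mem_span_singleton] at hmem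
  have h1 : elemY p ∣ y := (mul_dvd_mul_iff_left elemX_ne_zero).1 hmem
  have hy0 : y ≠ 0 := by
    rintro rfl
    exact not_elemX_dvd_elemY (by rw [hy, mul_zero]; exact dvd_zero _)
  rw [hy] at h1
  obtain ⟨c, hc⟩ := h1
  refine not_isUnit_natCast (p := p) (IsUnit.of_mul_eq_one c (mul_left_cancel₀ hy0 ?_))
  rw [mul_one]
  linear_combination -hc

/-- The element `1 / p` lies in the inverse of `(X, Y)`, so `1` cannot lie in the `v`-closure. -/
theorem vClosure_ne_one : vClosure (Ideal.span {elemX p, elemY p}) ≠ 1 := by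
  intro h
  obtain ⟨y, hy⟩ := natCast_dvd (p := p) (f := elemY p) (by simp [coe_elemY])
  obtain ⟨x, hx⟩ := natCast_dvd (p := p) (f := elemX p) (by simp [coe_elemX])
  have hp0 : (p : ringD p) ≠ 0 := left_ne_zero_of_mul (hx ▸ elemX_ne_zero)
  let K := FractionRing (ringD p)
  have hpK : algebraMap (ringD p) K p ≠ 0 := by
    simpa only [Ne, FaithfulSMul.algebraMap_eq_zero_iff] using hp0
  have hI : ((Ideal.span {elemX p, elemY p} : Ideal (ringD p)) :
      FractionalIdeal (nonZeroDivisors (ringD p)) K) ≠ 0 := by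
    rw [Ne, FractionalIdeal.coeIdeal_eq_zero]
    intro hb
    exact elemX_ne_zero (p := p)
      ((Ideal.mem_bot).1 (hb ▸ Ideal.subset_span (Set.mem_insert _ _)))
  have hmem : (algebraMap (ringD p) K p)⁻¹ ∈
      ((Ideal.span {elemX p, elemY p} : Ideal (ringD p)) :
        FractionalIdeal (nonZeroDivisors (ringD p)) K)⁻¹ := by
    rw [FractionalIdeal.mem_inv_iff hI]
    intro w hw
    obtain ⟨v, hv, rfl⟩ := (FractionalIdeal.mem_coeIdeal _).1 hw
    obtain ⟨a, b, rfl⟩ := Ideal.mem_span_pair.1 hv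
    rw [FractionalIdeal.mem_one_iff]
    refine ⟨a * x + b * y, ?_⟩
    rw [eq_inv_mul_iff_mul_eq₀ hpK, ← map_mul, hx, hy]
    congr 1
    ring
  have hI' : ((Ideal.span {elemX p, elemY p} : Ideal (ringD p)) :
      FractionalIdeal (nonZeroDivisors (ringD p)) K)⁻¹ ≠ 0 := fun h0 => by
    rw [h0, FractionalIdeal.mem_zero_iff] at hmem
    exact inv_ne_zero hpK hmem
  have h1 : (1 : K) ∈ vClosure (Ideal.span {elemX p, elemY p}) := by
    rw [h]; exact FractionalIdeal.one_mem_one _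
  obtain ⟨c, hc⟩ := (FractionalIdeal.mem_one_iff _).1
    ((FractionalIdeal.mem_inv_iff hI').1 h1 _ hmem)
  refine not_isUnit_natCast (p := p) (IsUnit.of_mul_eq_one c
    (IsFractionRing.injective (ringD p) K ?_))
  rw [map_mul, hc, one_mul, mul_inv_cancel₀ hpK, map_one]

/-- A common divisor `g` of `X` and `Y` has nonzero constant coefficient, so `pg` is again a common
divisor, and no common divisor is greatest. -/
theorem not_nonempty_gcdMonoid : ¬ Nonempty (GCDMonoid (ringD p)) := by
  rintro ⟨inst⟩
  let g := gcd (elemX p) (elemY p)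
  have hX : g ∣ elemX p := gcd_dvd_left _ _
  have hY : g ∣ elemY p := gcd_dvd_right _ _
  have hg0 : constantCoeff (g : MvPowerSeries (Fin 2) ℚ) ≠ 0 := fun h0 =>
    not_X_dvd_X (by decide : (0 : Fin 2) ≠ 1)
      ((X_dvd_of_dvd_X (i := 0) (coe_dvd_coe hX) h0).trans (coe_dvd_coe hY))
  have hpg : constantCoeff ((p * g : ringD p) : MvPowerSeries (Fin 2) ℚ) ≠ 0 := by
    simpa [hg0] using hp.out.ne_zero
  obtain ⟨c, hc⟩ : (p : ringD p) * g ∣ g :=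
    dvd_gcd (dvd_of_constantCoeff_ne_zero_of_eq_zero hpg (by simp [coe_elemX]))
      (dvd_of_constantCoeff_ne_zero_of_eq_zero hpg (by simp [coe_elemY]))
  have hg : g ≠ 0 := fun h => hg0 (by rw [h]; exact map_zero _)
  refine not_isUnit_natCast (p := p) (IsUnit.of_mul_eq_one c (mul_left_cancel₀ hg ?_))
  linear_combination -hc

end RingD

open RingD in
theorem mainTheorem12 (p : ℕ) [Fact p.Prime] :
    IsSchreier (ringD p) ∧
    IsSemirigid (ringD p) ∧
    IsSemiPacked (ringD p) ∧
    IsRigid (elemX p) ∧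
    IsRigid (elemY p) ∧
    ¬ IsVCoprime (elemX p) (elemY p) ∧
    vClosure (Ideal.span {elemX p, elemY p}) ≠ 1 ∧
    ¬ IsRigid (elemX p * elemY p) ∧
    ¬ IsSemirigidGCD (ringD p) := by
  refine ⟨⟨isIntegrallyClosed_ringD p, isPrimal_ringD⟩, fun a ha h1 => ?_, isSemiPacked_ringD p,
    (isPacked_of_prime_coe (prime_X 0)).1, (isPacked_of_prime_coe (prime_X 1)).1,
    not_isVCoprime, vClosure_ne_one, fun h => ?_, fun h => not_nonempty_gcdMonoid h.2⟩
  · obtain ⟨s, hs, hsa⟩ := isSemiPacked_ringD p a ha h1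
    exact ⟨s, fun q hq => (hs q hq).1, hsa⟩
  · exact (h.2.2 _ _ (dvd_mul_right _ _) (dvd_mul_left _ _)).elim
      not_elemX_dvd_elemY not_elemY_dvd_elemX
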